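/- For real $r$ let $$f(r)=\frac{4}{\pi^2}\sum_{k\ge 0}\frac{\sec\big((2k+1)\pi r\big)}{(2k+1)^2},$$ with values in $\mathbb{R}\cup\{\infty\}$, where $\sec x=1/\cos x$, $\sec x=\infty$ if $\cos x=0$, and $f(r)=\infty$ if one of the terms is infinite. Then for every positive integer $q$ $$f(1/q)=\begin{cases}\tfrac12 & \text{if } q\equiv 0 \pmod 4,\\ \tfrac12-\tfrac1q & \text{if } q\equiv 1 \pmod 4,\\ \infty & \text{if } q\equiv 2 \pmod 4,\\ \tfrac12+\tfrac1q & \text{if } q\equiv 3 \pmod 4.\end{cases}$$ If $q\not\equiv 2\pmod 4$, all terms of the series at $r=1/q$ are finite and the series converges absolutely. If $q\equiv 2\pmod 4$, then $1/q$ is a pole of all sufficiently late partial sums: for all sufficiently large $N$, $$\Big|\frac{4}{\pi^2}\sum_{k=0}^{N-1}\frac{\sec((2k+1)\pi r)}{(2k+1)^2}\Big|\to\infty\quad\text{as } r\to 1/q,\ r\ne 1/q.$$ -/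

import Mathlib

/-- The secant with values in the projectively extended line `ℝ ∪ {∞}`:
`sec x = 1 / cos x`, and `sec x = ∞` at the zeros of the cosine. -/
noncomputable def extSec (x : ℝ) : OnePoint ℝ :=
  open Classical in
  if Real.cos x = 0 then OnePoint.infty else (((Real.cos x)⁻¹ : ℝ) : OnePoint ℝ)

/-- The term `sec((2k+1)πr) / (2k+1)²` of the series, as a real number
(meaningful when `cos((2k+1)πr) ≠ 0`). -/
noncomputable def secTerm (r : ℝ) (k : ℕ) : ℝ :=
  (Real.cos ((2 * (k : ℝ) + 1) * Real.pi * r))⁻¹ / (2 * (k : ℝ) + 1) ^ 2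

/-- The partial sum `(4/π²) ∑_{k<N} sec((2k+1)πr) / (2k+1)²`. -/
noncomputable def secPartialSum (N : ℕ) (r : ℝ) : ℝ :=
  4 / Real.pi ^ 2 * ∑ k ∈ Finset.range N, secTerm r k

/-- The function `f(r) = (4/π²) ∑_{k≥0} sec((2k+1)πr) / (2k+1)²`, with values in `ℝ ∪ {∞}`:
it is `∞` where one of the secants is infinite, and the sum of the real series otherwise.
(Convergence of that real series is asserted separately wherever a finite value is claimed.) -/
noncomputable def secF (r : ℝ) : OnePoint ℝ :=
  open Classical in
  if ∃ k : ℕ, extSec ((2 * (k : ℝ) + 1) * Real.pi * r) = OnePoint.infty then OnePoint.infty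
  else ((4 / Real.pi ^ 2 * ∑' k : ℕ, secTerm r k : ℝ) : OnePoint ℝ)

open Filter Topology Finset

/-! For `4 ∤ q - 2`, at `x = (2k+1)π/q` the secant is a finite alternating sum of cosines of
multiples of `x`, with coefficients independent of `k`: multiplied by `cos x`, that sum telescopes.
The series thus becomes a finite combination of the Fourier series `∑ cos((2k+1)θ)/(2k+1)²`, which
is affine in `θ` on `[0, π]`.

For `q = 2(2a+1)` the terms singular at `1/q` are those with `k = a + (2a+1)j`. Their poles are
simple, with residues of size proportional to `1/(2j+1)³`. The residue at `j = 0` exceeds all the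
others together, so there is no cancellation once `N > a`. -/

theorem hasSum_cos_nat_mul_div_sq {θ : ℝ} (h₀ : 0 ≤ θ) (h₁ : θ ≤ 2 * Real.pi) :
    HasSum (fun n : ℕ => Real.cos (n * θ) / (n : ℝ) ^ 2)
      (Real.pi ^ 2 / 6 - Real.pi * θ / 2 + θ ^ 2 / 4) := by
  have hpi := Real.pi_pos
  have hx : θ / (2 * Real.pi) ∈ Set.Icc (0 : ℝ) 1 :=
    ⟨by positivity, (div_le_one (by positivity)).2 h₁⟩
  have h := hasSum_one_div_nat_pow_mul_cos one_ne_zero hx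
  have hB : (Polynomial.map (algebraMap ℚ ℝ) (Polynomial.bernoulli 2)).eval (θ / (2 * Real.pi))
      = (θ / (2 * Real.pi)) ^ 2 - θ / (2 * Real.pi) + 1 / 6 := by
    simp [Polynomial.bernoulli, sum_range_succ, bernoulli_two, bernoulli_one,
      bernoulli_zero, ← Polynomial.C_mul_X_pow_eq_monomial]
    ring
  rw [mul_one, hB] at h
  convert! h using 1
  · funext n
    have : 2 * Real.pi * n * (θ / (2 * Real.pi)) = n * θ := by field_simp
    rw [this]; ring
  · simp
    field_simp
    ring

/-- The even-indexed terms of the full series at `θ` are a quarter of the full series at `2θ`, hence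
the bound `θ ≤ π`. -/
theorem hasSum_cos_odd_mul_div_sq {θ : ℝ} (h₀ : 0 ≤ θ) (h₁ : θ ≤ Real.pi) :
    HasSum (fun k : ℕ => Real.cos ((2 * (k : ℝ) + 1) * θ) / (2 * (k : ℝ) + 1) ^ 2)
      (Real.pi ^ 2 / 8 - Real.pi * θ / 4) := by
  have hall := hasSum_cos_nat_mul_div_sq h₀ (by linarith)
  have heven := (hasSum_cos_nat_mul_div_sq (θ := 2 * θ) (by linarith) (by linarith)).mul_left
    (1 / 4 : ℝ)
  have hodd : Summable (fun k : ℕ => Real.cos ((2 * (k : ℝ) + 1) * θ) / (2 * (k : ℝ) + 1) ^ 2) := by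
    have := hall.summable.comp_injective (i := fun k : ℕ => 2 * k + 1)
      (fun a b hab => by simpa using hab)
    simpa [Function.comp_def] using this
  have hsum := HasSum.even_add_odd (f := fun n : ℕ => Real.cos (n * θ) / (n : ℝ) ^ 2)
    (m := 1 / 4 * (Real.pi ^ 2 / 6 - Real.pi * (2 * θ) / 2 + (2 * θ) ^ 2 / 4))
    (by
      convert! heven using 2 with k
      push_cast
      rw [show 2 * (k : ℝ) * θ = k * (2 * θ) by ring]
      ring)
    (by simpa using hodd.hasSum)
  have := hsum.unique hall
  have hval : ∑' k : ℕ, Real.cos ((2 * (k : ℝ) + 1) * θ) / (2 * (k : ℝ) + 1) ^ 2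
      = Real.pi ^ 2 / 8 - Real.pi * θ / 4 := by linear_combination this
  exact hval ▸ hodd.hasSum

/-! ### Secants as finite cosine sums; the finite values -/

/-- Telescoping via `2 cos x cos y = cos (x - y) + cos (x + y)`. For `q = 2m+1` the right side is
`±1` at the points needed. -/
theorem cos_mul_alternating_sum_even (x : ℝ) (m : ℕ) :
    Real.cos x * (1 + 2 * ∑ j ∈ range m, (-1) ^ (j + 1) * Real.cos (2 * (j + 1) * x))
      = (-1) ^ m * Real.cos ((2 * m + 1) * x) := by
  induction m with
  | zero => simp
  | succ m ih =>
    rw [sum_range_succ]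
    have h := Real.two_mul_cos_mul_cos x (2 * (m + 1) * x)
    rw [← Real.cos_neg (x - _), show -(x - 2 * (m + 1) * x) = (2 * m + 1) * x by ring,
      show x + 2 * (m + 1) * x = (2 * (m + 1) + 1) * x by ring] at h
    push_cast
    linear_combination ih + (-1) ^ (m + 1) * h

theorem two_cos_mul_alternating_sum_odd (x : ℝ) (m : ℕ) :
    Real.cos x * (2 * ∑ j ∈ range m, (-1) ^ j * Real.cos ((2 * j + 1) * x))
      = 1 - (-1) ^ m * Real.cos (2 * m * x) := by
  induction m with
  | zero => simp
  | succ m ih =>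
    rw [sum_range_succ]
    have h := Real.two_mul_cos_mul_cos x ((2 * m + 1) * x)
    rw [← Real.cos_neg (x - _), show -(x - (2 * m + 1) * x) = 2 * m * x by ring,
      show x + (2 * m + 1) * x = 2 * (m + 1) * x by ring] at h
    push_cast
    linear_combination ih + (-1) ^ m * h

theorem secF_eq_of_hasSum {r s : ℝ} (hcos : ∀ k : ℕ, Real.cos ((2 * (k : ℝ) + 1) * Real.pi * r) ≠ 0)
    (hs : HasSum (secTerm r) (Real.pi ^ 2 / 4 * s)) :
    Summable (secTerm r) ∧ secF r = (s : OnePoint ℝ) := by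
  refine ⟨hs.summable, ?_⟩
  have hfin : ¬ ∃ k : ℕ, extSec ((2 * (k : ℝ) + 1) * Real.pi * r) = OnePoint.infty := by
    rintro ⟨k, hk⟩
    rw [extSec, if_neg (hcos k)] at hk
    exact OnePoint.coe_ne_infty _ hk
  rw [secF, if_neg hfin, hs.tsum_eq]
  congr 1
  have := Real.pi_ne_zero
  field_simp

theorem cos_odd_mul_pi (k : ℕ) : Real.cos ((2 * (k : ℝ) + 1) * Real.pi) = -1 := by
  have := Real.cos_nat_mul_pi (2 * k + 1)
  push_cast at this
  rw [this, pow_succ, pow_mul]; simp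

theorem cos_odd_mul_pi_div_two (k : ℕ) : Real.cos ((2 * (k : ℝ) + 1) * Real.pi / 2) = 0 :=
  Real.cos_eq_zero_iff.2 ⟨k, by push_cast; ring⟩

theorem sum_range_alternating_affine (m : ℕ) (a b : ℝ) :
    ∑ j ∈ range m, (-1) ^ j * (a + b * (2 * j + 1)) = (1 - (-1) ^ m) / 2 * a - (-1) ^ m * m * b := by
  induction m with
  | zero => simp
  | succ m ih => rw [sum_range_succ, ih]; push_cast; ring

theorem secF_one_div_odd (m : ℕ) :
    Summable (secTerm (1 / (2 * m + 1 : ℝ))) ∧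
      secF (1 / (2 * m + 1 : ℝ)) = ((1 / 2 - (-1) ^ m / (2 * m + 1) : ℝ) : OnePoint ℝ) := by
  have hq : (0 : ℝ) < 2 * m + 1 := by positivity
  have hpi := Real.pi_pos
  have hid (k : ℕ) := cos_mul_alternating_sum_even
    ((2 * (k : ℝ) + 1) * Real.pi * (1 / (2 * m + 1))) m
  have hend (k : ℕ) : Real.cos ((2 * m + 1) * ((2 * (k : ℝ) + 1) * Real.pi * (1 / (2 * m + 1))))
      = -1 := by
    rw [← cos_odd_mul_pi k]; congr 1; field_simp
  have hsq : ((-1 : ℝ) ^ m) * (-1) ^ m = 1 := by rw [← mul_pow]; simp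
  have hcos (k : ℕ) : Real.cos ((2 * (k : ℝ) + 1) * Real.pi * (1 / (2 * m + 1))) ≠ 0 := by
    intro h
    have := hid k
    rw [h, hend k, zero_mul] at this
    simp at this
  refine secF_eq_of_hasSum hcos ?_
  -- The constant term 1 of the cosine sum is the case `θ = 0`.
  have hbase := hasSum_cos_odd_mul_div_sq le_rfl hpi.le
  have hj (j : ℕ) (hj : j ∈ range m) := (hasSum_cos_odd_mul_div_sq
    (θ := 2 * (j + 1) * (Real.pi / (2 * m + 1))) (by positivity) (by
      have : (j : ℝ) + 1 ≤ m := by exact_mod_cast mem_range.1 hj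
      rw [← mul_div_assoc, div_le_iff₀ hq]
      nlinarith)).mul_left ((-1 : ℝ) ^ (j + 1))
  have hS := ((hbase.add ((hasSum_sum hj).mul_left 2)).mul_left (-(-1 : ℝ) ^ m))
  convert! hS using 1
  · funext k
    have hinv : (Real.cos ((2 * (k : ℝ) + 1) * Real.pi * (1 / (2 * m + 1))))⁻¹ = -(-1) ^ m *
        (1 + 2 * ∑ j ∈ range m, (-1) ^ (j + 1) *
          Real.cos (2 * (j + 1) * ((2 * (k : ℝ) + 1) * Real.pi * (1 / (2 * m + 1))))) := by
      rw [inv_eq_iff_eq_inv, eq_comm, inv_eq_iff_eq_inv, eq_comm]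
      refine inv_eq_of_mul_eq_one_right ?_
      have := hid k
      rw [hend k] at this
      linear_combination (-(-1 : ℝ) ^ m) * this + hsq
    have hterms : ∑ j ∈ range m, (-1 : ℝ) ^ (j + 1) *
        (Real.cos ((2 * (k : ℝ) + 1) * (2 * (j + 1) * (Real.pi / (2 * m + 1)))) /
          (2 * (k : ℝ) + 1) ^ 2) = (∑ j ∈ range m, (-1 : ℝ) ^ (j + 1) *
        Real.cos (2 * (j + 1) * ((2 * (k : ℝ) + 1) * Real.pi * (1 / (2 * m + 1))))) /
          (2 * (k : ℝ) + 1) ^ 2 := by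
      rw [sum_div]
      refine sum_congr rfl fun j _ => ?_
      rw [mul_div_assoc]
      congr 3
      ring
    rw [secTerm, hinv, hterms, mul_zero, Real.cos_zero]
    ring
  · have h1 : ∑ j ∈ range m, (-1 : ℝ) ^ (j + 1) *
        (Real.pi ^ 2 / 8 - Real.pi * (2 * (j + 1) * (Real.pi / (2 * m + 1))) / 4) =
        ∑ j ∈ range m, (-1 : ℝ) ^ j * ((-(Real.pi ^ 2 / 8) + Real.pi ^ 2 / (4 * (2 * m + 1)))
          + Real.pi ^ 2 / (4 * (2 * m + 1)) * (2 * j + 1)) := by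
      refine sum_congr rfl fun j _ => ?_
      field_simp
      ring
    rw [h1, sum_range_alternating_affine]
    field_simp
    linear_combination (-8 * Real.pi * (2 * (m : ℝ) + 1)) * hsq

theorem secF_one_div_four_mul {m : ℕ} (hm : 0 < m) :
    Summable (secTerm (1 / (4 * m : ℝ))) ∧
      secF (1 / (4 * m : ℝ)) = ((1 / 2 : ℝ) : OnePoint ℝ) := by
  have hm' : (0 : ℝ) < m := by exact_mod_cast hm
  have hpi := Real.pi_pos
  -- Here `2mx` is an odd multiple of `π/2`, so the product is exactly 1; this gives both `cos x ≠
  -- 0` and the value of its inverse.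
  have hid (k : ℕ) : Real.cos ((2 * (k : ℝ) + 1) * Real.pi * (1 / (4 * m))) *
      (2 * ∑ j ∈ range m, (-1) ^ j *
        Real.cos ((2 * j + 1) * ((2 * (k : ℝ) + 1) * Real.pi * (1 / (4 * m))))) = 1 := by
    rw [two_cos_mul_alternating_sum_odd, show 2 * m * ((2 * (k : ℝ) + 1) * Real.pi * (1 / (4 * m)))
      = (2 * (k : ℝ) + 1) * Real.pi / 2 by field_simp; norm_num, cos_odd_mul_pi_div_two]
    simp
  refine secF_eq_of_hasSum (fun k => left_ne_zero_of_mul_eq_one (hid k)) ?_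
  have hj (j : ℕ) (hj : j ∈ range m) := (hasSum_cos_odd_mul_div_sq
    (θ := (2 * j + 1) * (Real.pi / (4 * m))) (by positivity) (by
      have : (j : ℝ) + 1 ≤ m := by exact_mod_cast mem_range.1 hj
      rw [← mul_div_assoc, div_le_iff₀ (by positivity)]
      nlinarith)).mul_left ((-1 : ℝ) ^ j)
  convert! (hasSum_sum hj).mul_left 2 using 1
  · funext k
    rw [secTerm, inv_eq_of_mul_eq_one_right (hid k), mul_div_assoc, sum_div]
    congr 1
    refine sum_congr rfl fun j _ => ?_
    rw [mul_div_assoc]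
    congr 3
    ring
  · have h1 : ∑ j ∈ range m, (-1 : ℝ) ^ j *
        (Real.pi ^ 2 / 8 - Real.pi * ((2 * j + 1) * (Real.pi / (4 * m))) / 4) =
        ∑ j ∈ range m, (-1 : ℝ) ^ j * (Real.pi ^ 2 / 8
          + -(Real.pi ^ 2 / (16 * m)) * (2 * j + 1)) := by
      refine sum_congr rfl fun j _ => ?_
      field_simp
      ring
    rw [h1, sum_range_alternating_affine]
    field_simp
    ring

/-! ### Poles of the partial sums -/

/-- The residue of `r ↦ secTerm r k` at `a`. -/
noncomputable def secTermResidue (a : ℝ) (k : ℕ) : ℝ :=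
  open Classical in
  if Real.cos ((2 * (k : ℝ) + 1) * Real.pi * a) = 0 then
    (-Real.sin ((2 * (k : ℝ) + 1) * Real.pi * a) * ((2 * (k : ℝ) + 1) * Real.pi))⁻¹ /
      (2 * (k : ℝ) + 1) ^ 2
  else 0

/-- At a zero of the cosine, `(r - a) / cos` is the inverse of a difference quotient, whose limit is
nonzero because the sine is `±1` there. -/
theorem tendsto_sub_mul_secTerm (a : ℝ) (k : ℕ) :
    Tendsto (fun r => (r - a) * secTerm r k) (𝓝[≠] a) (𝓝 (secTermResidue a k)) := by
  have hd : HasDerivAt (fun r => Real.cos ((2 * (k : ℝ) + 1) * Real.pi * r))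
      (-Real.sin ((2 * (k : ℝ) + 1) * Real.pi * a) * ((2 * (k : ℝ) + 1) * Real.pi)) a := by
    simpa using ((hasDerivAt_id a).const_mul ((2 * (k : ℝ) + 1) * Real.pi)).cos
  by_cases h : Real.cos ((2 * (k : ℝ) + 1) * Real.pi * a) = 0
  · have hsin : Real.sin ((2 * (k : ℝ) + 1) * Real.pi * a) ≠ 0 := by
      intro hs
      have := Real.sin_sq_add_cos_sq ((2 * (k : ℝ) + 1) * Real.pi * a)
      simp [h, hs] at this
    have hne : -Real.sin ((2 * (k : ℝ) + 1) * Real.pi * a) * ((2 * (k : ℝ) + 1) * Real.pi) ≠ 0 :=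
      mul_ne_zero (neg_ne_zero.2 hsin) (by positivity)
    have := ((hasDerivAt_iff_tendsto_slope.1 hd).inv₀ hne).div_const ((2 * (k : ℝ) + 1) ^ 2)
    rw [secTermResidue, if_pos h]
    refine this.congr fun r => ?_
    simp only [slope_def_field, h, sub_zero, inv_div, secTerm]
    ring
  · rw [secTermResidue, if_neg h]
    have hc : ContinuousAt (fun r => (r - a) * secTerm r k) a := by
      unfold secTerm
      exact (continuousAt_id.sub continuousAt_const).mul ((hd.continuousAt.inv₀ h).div_const _)
    have := hc.tendsto.mono_left (nhdsWithin_le_nhds (s := {a}ᶜ))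
    simpa using this

theorem tendsto_abs_secPartialSum_atTop {a : ℝ} {N : ℕ}
    (h : ∑ k ∈ range N, secTermResidue a k ≠ 0) :
    Tendsto (fun r : ℝ => |secPartialSum N r|) (𝓝[≠] a) atTop := by
  have hlim : Tendsto (fun r => |(r - a) * secPartialSum N r|) (𝓝[≠] a)
      (𝓝 |4 / Real.pi ^ 2 * ∑ k ∈ range N, secTermResidue a k|) := by
    refine Tendsto.abs (((tendsto_finsetSum (range N) fun k _ =>
      tendsto_sub_mul_secTerm a k).const_mul (4 / Real.pi ^ 2)).congr fun r => ?_)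
    rw [secPartialSum, ← mul_sum]
    ring
  have hpos : 0 < |4 / Real.pi ^ 2 * ∑ k ∈ range N, secTermResidue a k| :=
    abs_pos.2 (mul_ne_zero (by positivity) h)
  have hinv : Tendsto (fun r : ℝ => |r - a|⁻¹) (𝓝[≠] a) atTop := by
    refine tendsto_inv_nhdsGT_zero.comp (tendsto_nhdsWithin_iff.2 ⟨?_, ?_⟩)
    · have : ContinuousAt (fun r : ℝ => |r - a|) a := by fun_prop
      simpa using this.tendsto.mono_left (nhdsWithin_le_nhds (s := {a}ᶜ))
    · filter_upwards [self_mem_nhdsWithin] with r hr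
      exact abs_pos.2 (sub_ne_zero.2 hr)
  refine (hinv.atTop_mul_pos hpos hlim).congr' ?_
  filter_upwards [self_mem_nhdsWithin] with r hr
  have : |r - a| ≠ 0 := abs_ne_zero.2 (sub_ne_zero.2 hr)
  rw [abs_mul, inv_mul_cancel_left₀ this]

theorem abs_secTermResidue {a : ℝ} {k : ℕ} (h : Real.cos ((2 * (k : ℝ) + 1) * Real.pi * a) = 0) :
    |secTermResidue a k| = 1 / (Real.pi * (2 * (k : ℝ) + 1) ^ 3) := by
  have hsin : |Real.sin ((2 * (k : ℝ) + 1) * Real.pi * a)| = 1 := by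
    rw [← sq_eq_sq₀ (abs_nonneg _) zero_le_one, sq_abs]
    simpa [h] using Real.sin_sq_add_cos_sq ((2 * (k : ℝ) + 1) * Real.pi * a)
  have hk : (0 : ℝ) < 2 * (k : ℝ) + 1 := by positivity
  rw [secTermResidue, if_pos h, abs_div, abs_inv, abs_mul, abs_neg, hsin, abs_mul,
    abs_of_pos hk, abs_of_pos Real.pi_pos, abs_of_pos (pow_pos hk 2)]
  field_simp

theorem cos_odd_mul_pi_mul_one_div_eq_zero_iff (a k : ℕ) :
    Real.cos ((2 * (k : ℝ) + 1) * Real.pi * (1 / (2 * (2 * a + 1)))) = 0 ↔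
      ∃ j : ℕ, k = a + (2 * a + 1) * j := by
  have hpi := Real.pi_ne_zero
  have ha : (2 * (a : ℝ) + 1) ≠ 0 := by positivity
  rw [Real.cos_eq_zero_iff]
  constructor
  · rintro ⟨l, hl⟩
    field_simp at hl
    have hl' : (2 * (k : ℤ) + 1) = (2 * a + 1) * (2 * l + 1) := by
      have : (2 * (k : ℝ) + 1) = (2 * a + 1) * (2 * l + 1) := by linarith
      exact_mod_cast this
    -- The left side of `hl'` is positive, so `2l + 1 > 0`.
    have hl0 : 0 ≤ l := by
      by_contra hneg
      nlinarith
    lift l to ℕ using hl0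
    refine ⟨l, ?_⟩
    zify
    linarith
  · rintro ⟨j, rfl⟩
    refine ⟨j, ?_⟩
    push_cast
    field_simp
    ring

theorem sum_one_div_odd_cube_lt_one (N : ℕ) :
    ∑ j ∈ range N, 1 / (2 * (j : ℝ) + 3) ^ 3 < 1 := by
  -- With `n = 2j+3`, `1/n³ ≤ 1/(n-1) - 1/(n+1)`, and these differences telescope.
  have key : ∑ j ∈ range N, 1 / (2 * (j : ℝ) + 3) ^ 3 ≤ 1 / 2 - 1 / (2 * (N : ℝ) + 2) := by
    induction N with
    | zero => simp
    | succ N ih =>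
      rw [sum_range_succ]
      have : 1 / (2 * (N : ℝ) + 3) ^ 3 ≤ 1 / (2 * (N : ℝ) + 2) - 1 / (2 * ((N : ℝ) + 1) + 2) := by
        have hN : (0 : ℝ) ≤ N := N.cast_nonneg
        rw [div_sub_div _ _ (by positivity) (by positivity), div_le_div_iff₀ (by positivity)
          (by positivity)]
        nlinarith [mul_nonneg hN hN, mul_nonneg hN (mul_nonneg hN hN)]
      push_cast
      linarith
  have : 0 < 1 / (2 * (N : ℝ) + 2) := by positivity
  linarith

theorem sum_secTermResidue_ne_zero {a N : ℕ} (hN : a < N) :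
    ∑ k ∈ range N, secTermResidue (1 / (2 * (2 * a + 1))) k ≠ 0 := by
  set c := secTermResidue (1 / (2 * (2 * a + 1))) with hc
  have hval (j : ℕ) : |c (a + (2 * a + 1) * j)| =
      1 / (Real.pi * (2 * (a : ℝ) + 1) ^ 3) * (1 / (2 * (j : ℝ) + 1) ^ 3) := by
    rw [hc, abs_secTermResidue ((cos_odd_mul_pi_mul_one_div_eq_zero_iff a _).2 ⟨j, rfl⟩)]
    push_cast
    rw [div_mul_div_comm, show 2 * ((a : ℝ) + (2 * a + 1) * j) + 1 = (2 * a + 1) * (2 * j + 1) by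
      ring]
    ring
  -- Only singular indices contribute, and removing `a` leaves those with `j ≥ 1`; letting the
  -- shifted index run up to `N` overcounts harmlessly.
  have hrest : ∑ k ∈ (range N).erase a, |c k| ≤ ∑ j ∈ range N, |c (a + (2 * a + 1) * (j + 1))| := by
    rw [← sum_image (f := fun k => |c k|) (g := fun j => a + (2 * a + 1) * (j + 1))
      (fun i _ j _ hij => by simpa using hij)]
    rw [← sum_filter_ne_zero]
    refine sum_le_sum_of_subset_of_nonneg (fun k hk => ?_) fun _ _ _ => abs_nonneg _
    obtain ⟨hk, hne⟩ := mem_filter.1 hk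
    have hz : Real.cos ((2 * (k : ℝ) + 1) * Real.pi * (1 / (2 * (2 * a + 1)))) = 0 := by
      by_contra h
      exact hne (by rw [hc, secTermResidue, if_neg h, abs_zero])
    obtain ⟨j, rfl⟩ := (cos_odd_mul_pi_mul_one_div_eq_zero_iff a k).1 hz
    rw [mem_erase, mem_range] at hk
    obtain ⟨i, rfl⟩ : ∃ i, j = i + 1 :=
      Nat.exists_eq_succ_of_ne_zero fun h => hk.1 (by simp [h])
    exact mem_image.2 ⟨i, mem_range.2 (by nlinarith [hk.2]), rfl⟩
  have hlt : ∑ j ∈ range N, |c (a + (2 * a + 1) * (j + 1))| < |c a| := by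
    have h0 := hval 0
    simp only [mul_zero, add_zero, Nat.cast_zero] at h0
    rw [h0, sum_congr rfl fun j _ => hval (j + 1), ← mul_sum]
    refine mul_lt_mul_of_pos_left ?_ (by have := Real.pi_pos; positivity)
    convert! sum_one_div_odd_cube_lt_one N using 1
    · refine sum_congr rfl fun j _ => ?_
      push_cast
      congr 2
      ring
    · norm_num
  intro hzero
  rw [← add_sum_erase _ _ (mem_range.2 hN)] at hzero
  have h1 : |c a| ≤ ∑ k ∈ (range N).erase a, |c k| := by
    rw [eq_neg_of_add_eq_zero_left hzero, abs_neg]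
    exact abs_sum_le_sum_abs _ _
  linarith

theorem secF_one_div_two_mul_odd (a : ℕ) :
    secF (1 / (2 * (2 * a + 1))) = OnePoint.infty := by
  rw [secF, if_pos]
  refine ⟨a, ?_⟩
  rw [extSec, if_pos]
  exact (cos_odd_mul_pi_mul_one_div_eq_zero_iff a a).2 ⟨0, by simp⟩

theorem theorem3p1 (q : ℕ) (hq : 0 < q) :
    (q ≡ 0 [MOD 4] →
      Summable (secTerm (1 / (q : ℝ))) ∧
        secF (1 / (q : ℝ)) = ((1 / 2 : ℝ) : OnePoint ℝ)) ∧
    (q ≡ 1 [MOD 4] →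
      Summable (secTerm (1 / (q : ℝ))) ∧
        secF (1 / (q : ℝ)) = ((1 / 2 - 1 / (q : ℝ) : ℝ) : OnePoint ℝ)) ∧
    (q ≡ 2 [MOD 4] →
      secF (1 / (q : ℝ)) = OnePoint.infty ∧
        ∀ᶠ N : ℕ in Filter.atTop,
          Filter.Tendsto (fun r : ℝ => |secPartialSum N r|)
            (nhdsWithin (1 / (q : ℝ)) {1 / (q : ℝ)}ᶜ) Filter.atTop) ∧
    (q ≡ 3 [MOD 4] →
      Summable (secTerm (1 / (q : ℝ))) ∧
        secF (1 / (q : ℝ)) = ((1 / 2 + 1 / (q : ℝ) : ℝ) : OnePoint ℝ)) := by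
  refine ⟨fun h => ?_, fun h => ?_, fun h => ?_, fun h => ?_⟩
  · obtain ⟨m, rfl⟩ := (Nat.modEq_zero_iff_dvd.1 h)
    simpa using secF_one_div_four_mul (m := m) (by omega)
  · obtain ⟨m, rfl⟩ : ∃ m, q = 2 * (2 * m) + 1 := ⟨q / 4, by have : q % 4 = 1 := h; omega⟩
    simpa using secF_one_div_odd (2 * m)
  · obtain ⟨a, rfl⟩ : ∃ a, q = 2 * (2 * a + 1) := ⟨q / 4, by have : q % 4 = 2 := h; omega⟩
    push_cast
    refine ⟨secF_one_div_two_mul_odd a, ?_⟩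
    filter_upwards [eventually_gt_atTop a] with N hN
    exact tendsto_abs_secPartialSum_atTop (sum_secTermResidue_ne_zero hN)
  · obtain ⟨m, rfl⟩ : ∃ m, q = 2 * (2 * m + 1) + 1 := ⟨q / 4, by have : q % 4 = 3 := h; omega⟩
    have := secF_one_div_odd (2 * m + 1)
    rw [(odd_two_mul_add_one m).neg_one_pow, neg_div, sub_neg_eq_add] at this
    simpa using this
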